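/- Let $p$ be a prime. For $a\in\mathbb N=\{1,2,\dots\}$ put $A_a=\begin{pmatrix}0&1\\1&a\end{pmatrix}$, and for a finite word $u=a_1\dots a_n$ put $A_u=A_{a_1}\cdots A_{a_n}$ (the identity for the empty word). For $N\in\mathbb N$ let $\mathcal A_N=\{1,\dots,N\}$. For an infinite word $w=a_1a_2a_3\dots$ let $w_n=a_1\dots a_n$ ($n\ge 0$) denote its prefixes and $\mathrm Tw=a_2a_3\dots$ its shift. The word $w$ is recurrent if every finite block occurring in $w$ occurs in it infinitely often, and periodic if $\mathrm T^l w=w$ for some $l\ge 1$. For $k\in\mathbb N$ let $$U_k(w)=\{A_{w_n} \bmod p^k : n\ge 0\},\qquad \mathbf U_k=\{U_k(\mathrm T^m w) : m\ge 0\}.$$ For $\epsilon>0$ let $\mathbf{PBad}_\epsilon$ be the set of points $\mathbf q=(q_1:q_2)$ of the projective line $\mathbf P^1_{\mathbb Q_p}$ such that for all $(a,b)\in\mathbb Z^2\setminus\{(0,0)\}$ $$|aq_1+bq_2|_p\cdot\min\{|q_1|_p^{-1},|q_2|_p^{-1}\}\ \ge\ \epsilon\cdot\min\{|a|^{-2},|b|^{-2}\},$$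 where the inverse of $0$ is read as $+\infty$. Extend the shift to pairs by $\mathrm T(w,\mathbf q)=(\mathrm Tw,A_{a_1}\mathbf q)$, where $a_1$ is the first letter of $w$. Let $\mathbf{LMad}$ be the set of pairs $(w,\mathbf x_p)$ for which there is an $\epsilon>0$ such that, with $N_\epsilon=\lfloor\epsilon^{-1}\rfloor+1$, one has $\mathrm T^n(w,\mathbf x_p)\in\mathcal A_{N_\epsilon}^{\mathbb N}\times\mathbf{PBad}_\epsilon$ for every $n\ge 0$. **Proposition.** Let $N\in\mathbb N$ and let $w\in\mathcal A_N^{\mathbb N}$ be recurrent. Suppose that there is a constant $C$ with $\#\mathbf U_k\le C$ for every $k\in\mathbb N$. Then there are at most two points $\mathbf x_p\in\mathbf P^1_{\mathbb Q_p}$ such that $(w,\mathbf x_p)\in\mathbf{LMad}$. If moreover $w$ is not periodic, then $(w,\mathbf x_p)\notin\mathbf{LMad}$ for every $\mathbf x_p\in\mathbf P^1_{\mathbb Q_p}$. -/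

import Mathlib

open scoped LinearAlgebra.Projectivization MatrixGroups

namespace LimitMad

/-! Infinite words over `ℕ` are functions `w : ℕ → ℕ`; the first letter is `w 0`. -/

/-- The alphabet `{1, ..., N}`. -/
def alphabet (N : ℕ) : Set ℕ := Set.Icc 1 N

/-- The left shift on infinite words. -/
def shift (w : ℕ → ℕ) : ℕ → ℕ := fun i => w (i + 1)

/-- The prefix of length `n` of an infinite word. -/
def prefixWord (w : ℕ → ℕ) (n : ℕ) : List ℕ := (List.range n).map w

/-- Every finite block which occurs in `w` occurs in `w` infinitely often. -/
def IsRecurrent (w : ℕ → ℕ) : Prop :=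
  ∀ u : List ℕ, (∃ n, prefixWord (shift^[n] w) u.length = u) →
    {n | prefixWord (shift^[n] w) u.length = u}.Infinite

/-- `w = T^l w` for some positive `l`. -/
def IsPeriodic (w : ℕ → ℕ) : Prop := ∃ l, 0 < l ∧ shift^[l] w = w

/-- The matrix `(0 1; 1 a)` of determinant `-1`. Note that `GL(2, ℤ)` is the group of integer
matrices of determinant `1` or `-1`. -/
def letterMatrix (a : ℕ) : GL (Fin 2) ℤ :=
  ⟨!![0, 1; 1, (a : ℤ)], !![-(a : ℤ), 1; 1, 0],
    by simp [Matrix.one_fin_two], by simp [Matrix.one_fin_two]⟩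

/-- The product of the letter matrices along a finite word (from left to right). -/
def wordMatrix (u : List ℕ) : GL (Fin 2) ℤ := (u.map letterMatrix).prod

/-- Reduction of integer matrices modulo `p ^ k`. -/
def reduction (p k : ℕ) : GL (Fin 2) ℤ →* GL (Fin 2) (ZMod (p ^ k)) :=
  Matrix.GeneralLinearGroup.map (Int.castRingHom (ZMod (p ^ k)))

/-- `U_k(w)`: the matrices of all the prefixes of `w` (the empty one included) modulo `p ^ k`. -/
def prefixResidues (p k : ℕ) (w : ℕ → ℕ) : Set (GL (Fin 2) (ZMod (p ^ k))) :=
  Set.range fun n : ℕ => reduction p k (wordMatrix (prefixWord w n))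

/-- The collection of the distinct sets among `U_k(T^m w)`, `m ≥ 0`. -/
def residueCollection (p k : ℕ) (w : ℕ → ℕ) : Set (Set (GL (Fin 2) (ZMod (p ^ k)))) :=
  Set.range fun m : ℕ => prefixResidues p k (shift^[m] w)

variable (p : ℕ) [Fact p.Prime]

/-- The extended shift `T(w, q) = (T w, A_{w 0} q)` on pairs (infinite word, point of the
projective line over `ℚ_p`). -/
noncomputable def extShift (x : (ℕ → ℕ) × ℙ ℚ_[p] (Fin 2 → ℚ_[p])) :
    (ℕ → ℕ) × ℙ ℚ_[p] (Fin 2 → ℚ_[p]) :=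
  (shift x.1,
    Matrix.GeneralLinearGroup.map (Int.castRingHom ℚ_[p]) (letterMatrix (x.1 0)) • x.2)

/-- The points `(q₁ : q₂)` with
`|a q₁ + b q₂| * min (|q₁|⁻¹, |q₂|⁻¹) ≥ min (|a|⁻², |b|⁻²) * ε` for all integers `(a, b) ≠ (0, 0)`,
where the inverse of zero counts as infinity, so that the minimum of the two inverses is the
inverse of the maximum. The condition is homogeneous in `(q₁, q₂)`, see `mk_mem_pBad`. -/
def pBad (ε : ℝ) : Set (ℙ ℚ_[p] (Fin 2 → ℚ_[p])) :=
  {q | ∀ a b : ℤ, (a, b) ≠ (0, 0) →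
    (max (|(a : ℝ)| ^ 2) (|(b : ℝ)| ^ 2))⁻¹ * ε ≤
      ‖(a : ℚ_[p]) * q.rep 0 + (b : ℚ_[p]) * q.rep 1‖ * (max ‖q.rep 0‖ ‖q.rep 1‖)⁻¹}

/-- The condition defining `pBad` may be tested on any projective coordinates of the point. -/
theorem mk_mem_pBad (ε : ℝ) (v : Fin 2 → ℚ_[p]) (hv : v ≠ 0) :
    Projectivization.mk ℚ_[p] v hv ∈ pBad p ε ↔
      ∀ a b : ℤ, (a, b) ≠ (0, 0) →
        (max (|(a : ℝ)| ^ 2) (|(b : ℝ)| ^ 2))⁻¹ * ε ≤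
          ‖(a : ℚ_[p]) * v 0 + (b : ℚ_[p]) * v 1‖ * (max ‖v 0‖ ‖v 1‖)⁻¹ := by
  obtain ⟨c, hc⟩ := Projectivization.exists_smul_eq_mk_rep ℚ_[p] v hv
  have hc0 : ‖(c : ℚ_[p])‖ ≠ 0 := norm_ne_zero_iff.mpr c.ne_zero
  have key : ∀ a b : ℤ,
      ‖(a : ℚ_[p]) * (Projectivization.mk ℚ_[p] v hv).rep 0 +
          (b : ℚ_[p]) * (Projectivization.mk ℚ_[p] v hv).rep 1‖ *
        (max ‖(Projectivization.mk ℚ_[p] v hv).rep 0‖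
          ‖(Projectivization.mk ℚ_[p] v hv).rep 1‖)⁻¹ =
      ‖(a : ℚ_[p]) * v 0 + (b : ℚ_[p]) * v 1‖ * (max ‖v 0‖ ‖v 1‖)⁻¹ := by
    intro a b
    rw [← hc]
    have h1 : (a : ℚ_[p]) * (c • v) 0 + (b : ℚ_[p]) * (c • v) 1 =
        (c : ℚ_[p]) * ((a : ℚ_[p]) * v 0 + (b : ℚ_[p]) * v 1) := by
      simp only [Pi.smul_apply, Units.smul_def, smul_eq_mul]
      ring
    have h2 : max ‖(c • v) 0‖ ‖(c • v) 1‖ = ‖(c : ℚ_[p])‖ * max ‖v 0‖ ‖v 1‖ := by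
      simp only [Pi.smul_apply, Units.smul_def, smul_eq_mul, norm_mul]
      exact (mul_max_of_nonneg _ _ (norm_nonneg _)).symm
    rw [h1, h2, norm_mul, mul_inv]
    field_simp
  simp only [pBad, Set.mem_ofPred_eq, key]

/-- The pairs `x` such that `T^n x` lies, for every `n`, in the product of the words over
`{1, ..., N}` with `pBad p ε`, where `N = [ε⁻¹] + 1`. -/
def lMadOf (ε : ℝ) : Set ((ℕ → ℕ) × ℙ ℚ_[p] (Fin 2 → ℚ_[p])) :=
  {x | ∀ n : ℕ, (∀ i, ((extShift p)^[n] x).1 i ∈ alphabet (⌊ε⁻¹⌋₊ + 1)) ∧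
    ((extShift p)^[n] x).2 ∈ pBad p ε}

/-- The set `LMad`. -/
def lMad : Set ((ℕ → ℕ) × ℙ ℚ_[p] (Fin 2 → ℚ_[p])) :=
  {x | ∃ ε : ℝ, 0 < ε ∧ x ∈ lMadOf p ε}

end LimitMad

/-! Letter matrices are symmetric, so along the orbit of (w, V) a linear form v takes the values
V·A_{w_n}·v; membership in `lMad` bounds these away from 0, uniformly in n. The residue bound and
the pigeonhole principle give a tail y of w whose sets U_k, for all k at once, recur at infinitely
many return times m. At a return time, U_k(y) contains every power of A = A_{y_m} mod p^k, so the
bound passes to V·A^j·v for all j (`eigenForm_eq_zero_of_mem_lMad`). If V were not a left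
eigenvector of A, this would fail. By Cayley–Hamilton, V·A^j·v = r_j P + s_j Q with r_j + s_j ω =
ω^j, and the ratios s_j/r_j are p-adically dense near 0 (`exists_pow_omega_linearForm_dvd`). Taking
v with P/Q small and s_j/r_j close to -P/Q makes the values tend to 0 (`eigenForm_eq_zero`). So V
lies among at most two eigenlines. Moreover, the matrices of any two return prefixes share the
irrational eigenvector V, hence commute, hence so do the words themselves. Letting one return time
grow makes y periodic, and recurrence carries this over to w. -/

namespace LimitMad

/-! ### Powers of the unit ω in ℤ[ω], ω² = c + tω, near 1 modulo p. -/

section QuadraticPowers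

open QuadraticAlgebra

variable {p : ℕ} {c t : ℤ}

/-- As c is a unit, so is ω, and two powers of ω that agree modulo p² can be cancelled. Modulus p²
rather than p is what makes `prime_pow_congruences` valid for p = 2 too. -/
theorem exists_pow_omega_eq (hp : 0 < p) (hc : IsUnit c) :
    ∃ M : ℕ, 0 < M ∧ ∃ y : QuadraticAlgebra ℤ c t,
      (⟨0, 1⟩ : QuadraticAlgebra ℤ c t) ^ M = 1 + (p : QuadraticAlgebra ℤ c t) ^ 2 * y := by
  set x : QuadraticAlgebra ℤ c t := ⟨0, 1⟩ with hx
  have hunit : IsUnit x := by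
    obtain ⟨u, rfl⟩ := hc
    refine IsUnit.of_mul_eq_one (⟨-t * ↑u⁻¹, ↑u⁻¹⟩ : QuadraticAlgebra ℤ u t) ?_
    ext <;> simp [hx]
  obtain ⟨v, hv⟩ := hunit
  have : NeZero (p ^ 2) := ⟨by positivity⟩
  obtain ⟨m, n, hmn, h⟩ := Finite.exists_ne_map_eq_of_infinite
    (fun n : ℕ => (((x ^ n).re : ZMod (p ^ 2)), ((x ^ n).im : ZMod (p ^ 2))))
  wlog hlt : m < n generalizing m n
  · exact this n m hmn.symm h.symm (by omega)
  simp only [Prod.mk.injEq, ZMod.intCast_eq_intCast_iff_dvd_sub] at h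
  obtain ⟨⟨r, hr⟩, s, hs⟩ := h
  refine ⟨n - m, by omega, ↑(v⁻¹ ^ m) * ⟨r, s⟩, ?_⟩
  have key : x ^ n = x ^ m + (p : QuadraticAlgebra ℤ c t) ^ 2 * ⟨r, s⟩ := by
    have h2 : (p : QuadraticAlgebra ℤ c t) ^ 2 * ⟨r, s⟩ =
        ⟨(p : ℤ) ^ 2 * r, (p : ℤ) ^ 2 * s⟩ := by
      rw [pow_two]; ext <;> simp [pow_two]
    rw [h2]
    push_cast at hr hs
    ext
    · simp only [re_add]; linarith
    · simp only [im_add]; linarith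
  have hn : x ^ n = x ^ m * x ^ (n - m) := by rw [← pow_add]; congr 1; omega
  have hinv : (↑(v⁻¹ ^ m) : QuadraticAlgebra ℤ c t) * x ^ m = 1 := by
    rw [← hv, ← Units.val_pow_eq_pow_val, ← Units.val_mul]; simp
  calc x ^ (n - m) = (↑(v⁻¹ ^ m) * x ^ m) * x ^ (n - m) := by rw [hinv, one_mul]
    _ = ↑(v⁻¹ ^ m) * (x ^ n) := by rw [hn, mul_assoc]
    _ = _ := by rw [key, mul_add, hinv]; ring

/-- Expand (a + p²bω)^p: the linear term is p·a^(p-1)·p²b·ω with a^(p-1) ≡ 1, and the remaining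
terms contain (p²b)², which is p·b times p·(p²b). -/
theorem prime_pow_congruences (y : QuadraticAlgebra ℤ c t)
    (hre : (p : ℤ) ∣ y.re - 1) (him : (p : ℤ) ^ 2 ∣ y.im) :
    (p : ℤ) ∣ (y ^ p).re - 1 ∧ ∃ u : ℤ, (p : ℤ) ∣ u - 1 ∧ (y ^ p).im = p * y.im * u := by
  obtain ⟨a, b⟩ := y
  obtain ⟨b, rfl⟩ := him
  simp only at hre ⊢
  have hsplit : (⟨a, (p : ℤ) ^ 2 * b⟩ : QuadraticAlgebra ℤ c t) =
      QuadraticAlgebra.C a + ⟨0, (p : ℤ) ^ 2 * b⟩ := by ext <;> simp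
  obtain ⟨k, hk⟩ := Polynomial.powAddExpansion (QuadraticAlgebra.C a : QuadraticAlgebra ℤ c t)
    ⟨0, (p : ℤ) ^ 2 * b⟩ p
  rw [hsplit, hk, ← C_pow, ← C_pow, ← C_natCast]
  obtain ⟨k1, k2⟩ := k
  have ha : ∀ n : ℕ, (p : ℤ) ∣ a ^ n - 1 := fun n =>
    hre.trans (by simpa using sub_dvd_pow_sub_pow a 1 n)
  refine ⟨?_, a ^ (p - 1) + p * b * (k2 * (c + t * t)) + p * b * (k1 * t),
    ?_, ?_⟩
  · simp only [pow_two, re_add, re_mul, im_mul, re_C, im_C]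
    obtain ⟨r, hr⟩ := ha p
    exact ⟨r + k1 * (c * (p * b * (p * p * b))) + c * k2 * (t * (p * b * (p * p * b))), by
      push_cast
      linear_combination hr⟩
  · have := ha (p - 1)
    rw [show ∀ x y z : ℤ, x + y + z - 1 = (x - 1) + (y + z) by intros; ring]
    exact dvd_add this (dvd_add ⟨_, mul_assoc _ _ _⟩ ⟨_, mul_assoc _ _ _⟩)
  · simp only [pow_two, im_add, re_mul, im_mul, re_C, im_C]
    push_cast
    ring

theorem prime_pow_pow_congruences (y : QuadraticAlgebra ℤ c t)
    (hre : (p : ℤ) ∣ y.re - 1) (him : (p : ℤ) ^ 2 ∣ y.im) (e : ℕ) :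
    (p : ℤ) ∣ (y ^ p ^ e).re - 1 ∧
      ∃ u : ℤ, (p : ℤ) ∣ u - 1 ∧ (y ^ p ^ e).im = p ^ e * y.im * u := by
  induction e with
  | zero => exact ⟨by simpa using hre, 1, by simp⟩
  | succ e ih =>
    obtain ⟨h1, u, hu, h2⟩ := ih
    obtain ⟨h3, v, hv, h4⟩ := prime_pow_congruences (y ^ p ^ e) h1
      (by rw [h2]; exact (him.mul_left _).mul_right _)
    rw [pow_succ, pow_mul]
    refine ⟨h3, u * v, ?_, by rw [h4, h2]; ring⟩
    rw [show u * v - 1 = (u - 1) * v + (v - 1) by ring]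
    exact dvd_add (hu.mul_right _) hv

theorem pow_congruences (y : QuadraticAlgebra ℤ c t)
    (hre : (p : ℤ) ∣ y.re - 1) (him : (p : ℤ) ∣ y.im) (j : ℕ) :
    (p : ℤ) ∣ (y ^ j).re - 1 ∧ (p : ℤ) ∣ (y ^ j).im := by
  induction j with
  | zero => simp
  | succ j ih =>
    obtain ⟨⟨r, hr⟩, s, hs⟩ := ih
    obtain ⟨a, ha⟩ := hre
    obtain ⟨b, hb⟩ := him
    rw [pow_succ]
    simp only [re_mul, im_mul]
    refine ⟨⟨(y ^ j).re * a + r + c * s * y.im, ?_⟩,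
      ⟨(y ^ j).re * b + s * y.re + t * s * y.im, ?_⟩⟩
    · rw [hs]; linear_combination (y ^ j).re * ha + hr
    · rw [hs, hb]; ring

/-- One digit of the approximation: multiplying `g` by an element close to `1` whose second
coordinate is `b * u` moves the linear form `im - z * re` by `b`, up to a multiple of `b * p`. -/
theorem linearForm_mul_congruence (g y : QuadraticAlgebra ℤ c t) (b z u : ℤ)
    (hg : (p : ℤ) ∣ g.re - 1) (hg' : (p : ℤ) ∣ g.im) (hy : (p : ℤ) ∣ y.re - 1)
    (hu : (p : ℤ) ∣ u - 1) (hyb : y.im = b * u) (hl : b ∣ g.im - g.re * z) :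
    b * p ∣ ((g * y).im - (g * y).re * z) - (g.im - g.re * z + b) := by
  obtain ⟨r, hr⟩ := hg
  obtain ⟨s, hs⟩ := hg'
  obtain ⟨a, ha⟩ := hy
  obtain ⟨v, hv⟩ := hu
  obtain ⟨l, hl⟩ := hl
  refine ⟨a * l + v * g.re + r + u * s * (t - c * z), ?_⟩
  simp only [re_mul, im_mul]
  have h1 : u = 1 + p * v := by linarith
  linear_combination (t * g.im + g.re - c * g.im * z) * hyb + (y.re - 1) * hl + b * l * ha +
    b * u * (t - c * z) * hs + b * g.re * hv + b * hr

/-- The p-adic digits of the target ratio are matched one at a time: each factor y^(p^e) shifts the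
error by p^e·`y.im`, up to a multiple of p^(e+1)·`y.im`. -/
theorem exists_pow_linearForm_dvd [hp : Fact p.Prime] (y : QuadraticAlgebra ℤ c t)
    (hre : (p : ℤ) ∣ y.re - 1) (him : (p : ℤ) ^ 2 ∣ y.im) (z : ℤ) (e : ℕ) :
    ∃ j : ℕ, (p : ℤ) ^ e * y.im ∣ (y ^ j).im - (y ^ j).re * (y.im * z) := by
  have him' : (p : ℤ) ∣ y.im := (Dvd.intro_left _ (by ring : (p : ℤ) * p = p ^ 2)).trans him
  have hp0 := hp.out.pos
  induction e with
  | zero => exact ⟨0, by simp⟩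
  | succ e ih =>
    obtain ⟨j, m, hm⟩ := ih
    obtain ⟨h1, u, hu, h2⟩ := prime_pow_pow_congruences y hre him e
    have step : ∀ i : ℕ, (p : ℤ) ^ e * y.im * p ∣
        ((y ^ (j + p ^ e * i)).im - (y ^ (j + p ^ e * i)).re * (y.im * z)) -
          (p : ℤ) ^ e * y.im * (m + i) := by
      intro i
      induction i with
      | zero => simp [hm]
      | succ i ih =>
        have hg := pow_congruences y hre him' (j + p ^ e * i)
        have := linearForm_mul_congruence (y ^ (j + p ^ e * i)) (y ^ p ^ e)
          ((p : ℤ) ^ e * y.im) (y.im * z) u hg.1 hg.2 h1 hu h2 (by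
            have := dvd_trans (Dvd.intro _ rfl) ih
            simpa using dvd_add this (Dvd.intro (m + i : ℤ) rfl))
        rw [← pow_add, show j + p ^ e * i + p ^ e = j + p ^ e * (i + 1) by ring] at this
        have h3 := dvd_add this ih
        push_cast at h3 ⊢
        refine h3.trans (dvd_of_eq ?_)
        ring
    -- The number of factors y^(p^e) that cancels the current digit m.
    obtain ⟨i, hi⟩ : ∃ i : ℕ, (p : ℤ) ∣ m + i := by
      refine ⟨((-m) % p).toNat, ?_⟩
      rw [Int.toNat_of_nonneg (Int.emod_nonneg _ (by exact_mod_cast hp0.ne'))]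
      have := Int.emod_add_mul_ediv (-m) p
      exact ⟨-((-m) / p), by linarith⟩
    refine ⟨j + p ^ e * i, ?_⟩
    have h4 := dvd_add (step i) (mul_dvd_mul_left ((p : ℤ) ^ e * y.im) hi)
    rw [show (p : ℤ) ^ (e + 1) * y.im = (p : ℤ) ^ e * y.im * p by ring]
    simpa using h4

/-- Ratios of the coordinates of powers of `ω` are `p`-adically dense near `0`. -/
theorem exists_pow_omega_linearForm_dvd [hp : Fact p.Prime] (hc : IsUnit c)
    (hne : ∀ n : ℕ, 0 < n → ((⟨0, 1⟩ : QuadraticAlgebra ℤ c t) ^ n).im ≠ 0) :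
    ∃ b : ℤ, b ≠ 0 ∧ ∀ (z : ℤ) (e : ℕ), ∃ j : ℕ,
      (p : ℤ) ^ e ∣ ((⟨0, 1⟩ : QuadraticAlgebra ℤ c t) ^ j).im -
        ((⟨0, 1⟩ : QuadraticAlgebra ℤ c t) ^ j).re * (b * z) := by
  obtain ⟨M, hM, y, hy⟩ := exists_pow_omega_eq (c := c) (t := t) hp.out.pos hc
  -- Powers of ω^M alone suffice; its second coordinate b sets the radius within which ratios are
  -- approximated.
  refine ⟨((⟨0, 1⟩ : QuadraticAlgebra ℤ c t) ^ M).im, hne M hM, fun z e => ?_⟩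
  have h2 : (p : QuadraticAlgebra ℤ c t) ^ 2 * y = ⟨(p : ℤ) ^ 2 * y.re, (p : ℤ) ^ 2 * y.im⟩ := by
    rw [pow_two]; ext <;> simp [pow_two]
  rw [h2] at hy
  obtain ⟨j, hj⟩ := exists_pow_linearForm_dvd (p := p)
    ((⟨0, 1⟩ : QuadraticAlgebra ℤ c t) ^ M)
    (by rw [hy]; simp [pow_two, mul_assoc])
    (by rw [hy]; simp) z e
  rw [← pow_mul] at hj
  exact ⟨M * j, dvd_trans (Dvd.intro _ rfl) hj⟩

end QuadraticPowers

open scoped Matrix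

/-! ### Orbits bounded away from 0 force eigenvectors. -/

section Orbit

open scoped QuadraticAlgebra

variable {p : ℕ} [Fact p.Prime]

/-- The value of the integral linear form with coefficients `v` at the vector `V`. -/
noncomputable def pairing (V : Fin 2 → ℚ_[p]) (v : Fin 2 → ℤ) : ℚ_[p] := v 0 * V 0 + v 1 * V 1

theorem pairing_mulVec (V : Fin 2 → ℚ_[p]) (A : Matrix (Fin 2) (Fin 2) ℤ) (v : Fin 2 → ℤ) :
    pairing V (A *ᵥ v) =
      (A 0 0 * v 0 + A 0 1 * v 1) * V 0 + (A 1 0 * v 0 + A 1 1 * v 1) * V 1 := by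
  simp [pairing, Matrix.mulVec, dotProduct, Fin.sum_univ_two]

/-- The powers of a matrix are given by the powers of the root of its characteristic
polynomial. -/
theorem matrix_pow_apply (A : Matrix (Fin 2) (Fin 2) ℤ) (n : ℕ) (i j : Fin 2) :
    (A ^ n) i j = ((⟨0, 1⟩ : QuadraticAlgebra ℤ (-A.det) A.trace) ^ n).re * (if i = j then 1 else 0) +
      ((⟨0, 1⟩ : QuadraticAlgebra ℤ (-A.det) A.trace) ^ n).im * A i j := by
  induction n generalizing i j with
  | zero => simp [Matrix.one_apply]
  | succ n ih =>
    rw [pow_succ, Matrix.mul_apply, Fin.sum_univ_two, ih, ih, pow_succ]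
    rw [QuadraticAlgebra.re_mul, QuadraticAlgebra.im_mul]
    generalize ((⟨0, 1⟩ : QuadraticAlgebra ℤ (-A.det) A.trace) ^ n).re = r
    generalize ((⟨0, 1⟩ : QuadraticAlgebra ℤ (-A.det) A.trace) ^ n).im = s
    have hd := Matrix.det_fin_two A
    have ht := Matrix.trace_fin_two A
    generalize A.det = d at hd ⊢
    generalize A.trace = t at ht ⊢
    subst hd ht
    fin_cases i <;> fin_cases j <;> simp <;> ring

theorem pairing_matrix_pow (V : Fin 2 → ℚ_[p]) (A : Matrix (Fin 2) (Fin 2) ℤ) (v : Fin 2 → ℤ)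
    (n : ℕ) :
    pairing V (A ^ n *ᵥ v) =
      ((⟨0, 1⟩ : QuadraticAlgebra ℤ (-A.det) A.trace) ^ n).re * pairing V v +
      ((⟨0, 1⟩ : QuadraticAlgebra ℤ (-A.det) A.trace) ^ n).im * pairing V (A *ᵥ v) := by
  rw [pairing_mulVec, pairing_mulVec, pairing, matrix_pow_apply, matrix_pow_apply,
    matrix_pow_apply, matrix_pow_apply]
  simp
  ring

/-- The quadratic form on row vectors whose zeros are the left eigenvectors of `A`. -/
noncomputable def eigenForm (A : Matrix (Fin 2) (Fin 2) ℤ) (V : Fin 2 → ℚ_[p]) : ℚ_[p] :=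
  A 0 1 * V 0 ^ 2 + (A 1 1 - A 0 0) * V 0 * V 1 - A 1 0 * V 1 ^ 2

/-- The p-adic vector s·(-V₁, V₀), with s making it integral, annihilates V, while its image under A
pairs with V to s·`eigenForm A V` ≠ 0. The strict inequality is an open condition and ℤ is dense in
ℤ_p. -/
theorem exists_int_vector_pairing_lt (A : Matrix (Fin 2) (Fin 2) ℤ) (V : Fin 2 → ℚ_[p])
    (hV : eigenForm A V ≠ 0) (b : ℚ_[p]) (hb : b ≠ 0) :
    ∃ v : Fin 2 → ℤ, ‖pairing V v‖ < ‖b‖ * ‖pairing V (A *ᵥ v)‖ := by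
  obtain ⟨s, hs0, hs1, hs2⟩ : ∃ s : ℚ_[p], s ≠ 0 ∧ ‖s * V 0‖ ≤ 1 ∧ ‖s * V 1‖ ≤ 1 := by
    have hp : Filter.Tendsto (fun n : ℕ => (p : ℚ_[p]) ^ n) Filter.atTop (nhds 0) :=
      tendsto_pow_atTop_nhds_zero_of_norm_lt_one Padic.norm_p_lt_one
    have h : ∀ i, ∀ᶠ n in Filter.atTop, ‖(p : ℚ_[p]) ^ n * V i‖ < 1 := fun i => by
      have := (hp.mul_const (V i)).norm
      rw [zero_mul, norm_zero] at this
      exact this.eventually_lt_const one_pos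
    obtain ⟨n, h0, h1⟩ := ((h 0).and (h 1)).exists
    exact ⟨(p : ℚ_[p]) ^ n, pow_ne_zero _ (by exact_mod_cast (Fact.out : p.Prime).ne_zero),
      h0.le, h1.le⟩
  let P : ℤ_[p] × ℤ_[p] → ℚ_[p] := fun x => x.1 * V 0 + x.2 * V 1
  let Q : ℤ_[p] × ℤ_[p] → ℚ_[p] := fun x =>
    (A 0 0 * x.1 + A 0 1 * x.2) * V 0 + (A 1 0 * x.1 + A 1 1 * x.2) * V 1
  have hcoe : Continuous (fun x : ℤ_[p] => (x : ℚ_[p])) := continuous_subtype_val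
  have hP : Continuous P := by fun_prop
  have hQ : Continuous Q := by fun_prop
  have hopen : IsOpen {x | ‖P x‖ < ‖b‖ * ‖Q x‖} :=
    isOpen_lt hP.norm (continuous_const.mul hQ.norm)
  have hdense := (PadicInt.denseRange_intCast (p := p)).prodMap
    (PadicInt.denseRange_intCast (p := p))
  obtain ⟨⟨m, n⟩, hmn⟩ := hdense.exists_mem_open hopen
    ⟨(⟨-(s * V 1), by simpa using hs2⟩, ⟨s * V 0, hs1⟩), by
      have h1 : P (⟨-(s * V 1), by simpa using hs2⟩, ⟨s * V 0, hs1⟩) = 0 := by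
        simp only [P]; ring
      have h2 : Q (⟨-(s * V 1), by simpa using hs2⟩, ⟨s * V 0, hs1⟩) = s * eigenForm A V := by
        simp only [Q, eigenForm]; ring
      rw [Set.mem_ofPred_eq, h1, h2, norm_zero]
      exact mul_pos (norm_pos_iff.mpr hb) (norm_pos_iff.mpr (mul_ne_zero hs0 hV))⟩
  refine ⟨![m, n], ?_⟩
  rw [pairing_mulVec, pairing]
  simpa [P, Q] using hmn

theorem exists_int_norm_sub_le (Z : ℚ_[p]) (hZ : ‖Z‖ ≤ 1) (e : ℕ) :
    ∃ z : ℤ, ‖(z : ℚ_[p]) - Z‖ ≤ (p : ℝ) ^ (-e : ℤ) := by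
  obtain ⟨Z, rfl⟩ : ∃ Y : ℤ_[p], (Y : ℚ_[p]) = Z := ⟨⟨Z, hZ⟩, rfl⟩
  refine ⟨(Z.appr e : ℕ), ?_⟩
  have := (PadicInt.norm_le_pow_iff_mem_span_pow _ e).mpr (PadicInt.appr_spec e Z)
  rw [norm_sub_rev, Int.cast_natCast]
  rwa [PadicInt.norm_def, PadicInt.coe_sub, PadicInt.coe_natCast] at this

/-- If the orbit of `V` under the powers of `A` stays away from the zeros of every nonzero
integral linear form, then `V` is a left eigenvector of `A`. -/
theorem eigenForm_eq_zero (A : Matrix (Fin 2) (Fin 2) ℤ) (hdet : IsUnit A.det)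
    (hpow : ∀ n : ℕ, 0 < n → (A ^ n) 0 1 ≠ 0) (V : Fin 2 → ℚ_[p])
    (h : ∀ v : Fin 2 → ℤ, v ≠ 0 → ∃ η : ℝ, 0 < η ∧ ∀ j : ℕ, η ≤ ‖pairing V (A ^ j *ᵥ v)‖) :
    eigenForm A V = 0 := by
  by_contra hV
  -- If ω^n had second coordinate 0, then A^n would be scalar, against `hpow`.
  obtain ⟨b, hb, happ⟩ := exists_pow_omega_linearForm_dvd (p := p) (c := -A.det) (t := A.trace)
    hdet.neg (fun n hn h0 => hpow n hn (by rw [matrix_pow_apply, h0]; simp))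
  have hb' : (b : ℚ_[p]) ≠ 0 := by exact_mod_cast hb
  obtain ⟨v, hv⟩ := exists_int_vector_pairing_lt A V hV b hb'
  have hv0 : v ≠ 0 := by
    rintro rfl
    simp [pairing] at hv
  obtain ⟨η, hη, hbad⟩ := h v hv0
  have hpair := pairing_matrix_pow V A v
  set P := pairing V v
  set Q := pairing V (A *ᵥ v)
  have hQ : Q ≠ 0 := by
    intro hQ
    rw [hQ, norm_zero, mul_zero] at hv
    exact absurd hv (not_lt.mpr (norm_nonneg _))
  have hp1 : (p : ℝ)⁻¹ < 1 := inv_lt_one_of_one_lt₀ (by exact_mod_cast (Fact.out : p.Prime).one_lt)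
  obtain ⟨e, he⟩ : ∃ e : ℕ, (p : ℝ) ^ (-e : ℤ) * ‖Q‖ < η := by
    obtain ⟨e, he⟩ := exists_pow_lt_of_lt_one (div_pos hη (norm_pos_iff.mpr hQ)) hp1
    refine ⟨e, ?_⟩
    rw [zpow_neg, zpow_natCast, ← inv_pow]
    exact (lt_div_iff₀ (norm_pos_iff.mpr hQ)).mp he
  -- The ratio im/re to aim for is -P/Q; it is b times a p-adic integer because ‖P‖ < ‖b‖‖Q‖.
  obtain ⟨z, hz⟩ := exists_int_norm_sub_le (-P / ((b : ℚ_[p]) * Q)) (by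
    rw [norm_div, norm_neg, norm_mul]
    exact div_le_one_of_le₀ hv.le (by positivity)) e
  obtain ⟨j, hj⟩ := happ z e
  specialize hbad j
  rw [hpair] at hbad
  generalize (⟨0, 1⟩ : QuadraticAlgebra ℤ (-A.det) A.trace) ^ j = g at hbad hj
  have hj' := (Padic.norm_int_le_pow_iff_dvd (p := p) (g.im - g.re * (b * z)) e).mpr
    (by exact_mod_cast hj)
  have key : (g.re : ℚ_[p]) * P + g.im * Q =
      ((g.im - g.re * (b * z) : ℤ) : ℚ_[p]) * Q +
        g.re * b * ((z : ℚ_[p]) - -P / (b * Q)) * Q := by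
    push_cast
    field_simp
    ring
  rw [key] at hbad
  refine absurd hbad (not_le.mpr (lt_of_le_of_lt (Padic.nonarchimedean _ _) (max_lt ?_ ?_)))
  · rw [norm_mul]
    exact lt_of_le_of_lt (mul_le_mul_of_nonneg_right hj' (norm_nonneg _)) he
  · rw [norm_mul, norm_mul]
    refine lt_of_le_of_lt (mul_le_mul_of_nonneg_right ?_ (norm_nonneg _)) he
    refine (mul_le_of_le_one_left (norm_nonneg _) ?_).trans hz
    rw [← Int.cast_mul]
    exact Padic.norm_int_le_one _

end Orbit

/-! ### Words and their matrices. -/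

section Words

theorem shift_iterate_apply (w : ℕ → ℕ) (n i : ℕ) : (shift^[n] w) i = w (i + n) := by
  induction n generalizing i with
  | zero => simp
  | succ n ih =>
    rw [Function.iterate_succ_apply', shift, ih]
    congr 1; omega

theorem length_prefixWord (w : ℕ → ℕ) (n : ℕ) : (prefixWord w n).length = n := by
  simp [prefixWord]

theorem getElem_prefixWord (w : ℕ → ℕ) (n i : ℕ) (h : i < (prefixWord w n).length) :
    (prefixWord w n)[i] = w i := by
  simp [prefixWord]

theorem prefixWord_add (w : ℕ → ℕ) (m n : ℕ) :
    prefixWord w (m + n) = prefixWord w m ++ prefixWord (shift^[m] w) n := by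
  rw [prefixWord, List.range_add, List.map_append, List.map_map]
  refine congrArg _ (List.map_congr_left fun i _ => ?_)
  rw [shift_iterate_apply, Function.comp_apply, add_comm]

theorem prefixWord_succ (w : ℕ → ℕ) (n : ℕ) : prefixWord w (n + 1) = prefixWord w n ++ [w n] := by
  simp [prefixWord, List.range_succ]

theorem wordMatrix_append (u v : List ℕ) : wordMatrix (u ++ v) = wordMatrix u * wordMatrix v := by
  simp [wordMatrix]

theorem wordMatrix_singleton (a : ℕ) : wordMatrix [a] = letterMatrix a := by
  simp [wordMatrix]

/-- The entries are nonnegative, and those in the second column are positive. -/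
def SecondColumnPos (A : Matrix (Fin 2) (Fin 2) ℤ) : Prop :=
  0 ≤ A 0 0 ∧ 0 ≤ A 1 0 ∧ 0 < A 0 1 ∧ 0 < A 1 1

theorem SecondColumnPos.mul {A B : Matrix (Fin 2) (Fin 2) ℤ} (hA : SecondColumnPos A)
    (hB : SecondColumnPos B) : SecondColumnPos (A * B) := by
  obtain ⟨h1, h2, h3, h4⟩ := hA
  obtain ⟨k1, k2, k3, k4⟩ := hB
  simp only [SecondColumnPos, Matrix.mul_apply, Fin.sum_univ_two]
  refine ⟨?_, ?_, ?_, ?_⟩ <;> positivity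

theorem SecondColumnPos.pow {A : Matrix (Fin 2) (Fin 2) ℤ} (hA : SecondColumnPos A) {n : ℕ}
    (hn : 0 < n) : SecondColumnPos (A ^ n) := by
  induction n, hn using Nat.le_induction with
  | base => simpa using hA
  | succ n _ ih => rw [pow_succ]; exact ih.mul hA

theorem letterMatrix_secondColumnPos {a : ℕ} (ha : 1 ≤ a) :
    SecondColumnPos (letterMatrix a).val := by
  simp [SecondColumnPos, letterMatrix]; omega

theorem wordMatrix_prefixWord_secondColumnPos {w : ℕ → ℕ} (hw : ∀ i, 1 ≤ w i) {n : ℕ}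
    (hn : 0 < n) : SecondColumnPos (wordMatrix (prefixWord w n)).val := by
  induction n, hn using Nat.le_induction with
  | base => simpa [prefixWord, wordMatrix] using letterMatrix_secondColumnPos (hw 0)
  | succ n _ ih =>
    rw [prefixWord_succ, wordMatrix_append, wordMatrix_singleton, Units.val_mul]
    exact ih.mul (letterMatrix_secondColumnPos (hw n))

theorem letterMatrix_mulVec (a : ℕ) (v : Fin 2 → ℤ) :
    (letterMatrix a).val *ᵥ v = ![v 1, v 0 + a * v 1] := by
  ext i
  fin_cases i <;> simp [letterMatrix, Matrix.mulVec, dotProduct, Fin.sum_univ_two]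

theorem wordMatrix_cons_mulVec (a : ℕ) (u : List ℕ) (v : Fin 2 → ℤ) :
    (wordMatrix (a :: u)).val *ᵥ v = (letterMatrix a).val *ᵥ ((wordMatrix u).val *ᵥ v) := by
  have h : wordMatrix (a :: u) = letterMatrix a * wordMatrix u := by simp [wordMatrix]
  rw [h, Units.val_mul, Matrix.mulVec_mulVec]

/-- The cone 0 < x < y is stable under (x, y) ↦ (y, x + ay), so a can be recovered as the quotient
in a division with remainder. Starting from (0, 1) would not do: the letter 1 takes it to (1, 1). -/
theorem wordMatrix_mulVec_lt (u : List ℕ) (hu : ∀ a ∈ u, 1 ≤ a) :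
    0 < ((wordMatrix u).val *ᵥ ![1, 2]) 0 ∧
      ((wordMatrix u).val *ᵥ ![1, 2]) 0 < ((wordMatrix u).val *ᵥ ![1, 2]) 1 := by
  induction u with
  | nil => simp [wordMatrix]
  | cons a u ih =>
    obtain ⟨h1, h2⟩ := ih fun b hb => hu b (by simp [hb])
    have ha : (1 : ℤ) ≤ a := by exact_mod_cast hu a (by simp)
    rw [wordMatrix_cons_mulVec, letterMatrix_mulVec]
    simp only [Matrix.cons_val_zero, Matrix.cons_val_one]
    exact ⟨by linarith, by nlinarith⟩

/-- Words of the same length with positive letters are determined by their matrices. -/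
theorem eq_of_wordMatrix_eq {u v : List ℕ} (hu : ∀ a ∈ u, 1 ≤ a) (hv : ∀ a ∈ v, 1 ≤ a)
    (hlen : u.length = v.length) (h : wordMatrix u = wordMatrix v) : u = v := by
  induction u generalizing v with
  | nil => exact (List.length_eq_zero_iff.mp hlen.symm).symm
  | cons a u ih =>
    obtain _ | ⟨b, v⟩ := v
    · simp at hlen
    have hu' : ∀ c ∈ u, 1 ≤ c := fun c hc => hu c (by simp [hc])
    have hv' : ∀ c ∈ v, 1 ≤ c := fun c hc => hv c (by simp [hc])
    have hab : a = b := by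
      have h1 := wordMatrix_mulVec_lt u hu'
      have h2 := wordMatrix_mulVec_lt v hv'
      have h3 : (wordMatrix (a :: u)).val *ᵥ ![1, 2] = (wordMatrix (b :: v)).val *ᵥ ![1, 2] := by
        rw [h]
      rw [wordMatrix_cons_mulVec, wordMatrix_cons_mulVec, letterMatrix_mulVec,
        letterMatrix_mulVec] at h3
      have h4 := congrFun h3 0
      have h5 := congrFun h3 1
      simp only [Matrix.cons_val_zero, Matrix.cons_val_one] at h4 h5
      generalize ((wordMatrix u).val *ᵥ ![1, 2]) 0 = x at *
      generalize ((wordMatrix u).val *ᵥ ![1, 2]) 1 = y at *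
      generalize ((wordMatrix v).val *ᵥ ![1, 2]) 0 = x' at *
      generalize ((wordMatrix v).val *ᵥ ![1, 2]) 1 = y' at *
      subst h4
      have h6 : x - x' = (b - a : ℤ) * y := by linarith
      have h7 : (b - a : ℤ) < 1 := by
        by_contra hcon
        nlinarith
      have h8 : (-1 : ℤ) < b - a := by
        by_contra hcon
        nlinarith
      omega
    subst hab
    rw [ih hu' hv' (by simpa using hlen)]
    have : letterMatrix a * wordMatrix u = letterMatrix a * wordMatrix v := by
      simpa [wordMatrix] using h
    exact mul_left_cancel this

theorem one_le_of_mem_prefixWord {w : ℕ → ℕ} (hw : ∀ i, 1 ≤ w i) (n : ℕ) :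
    ∀ a ∈ prefixWord w n, 1 ≤ a := by
  intro a ha
  obtain ⟨i, -, rfl⟩ := List.mem_map.mp ha
  exact hw i

/-- If the matrices of two prefixes commute, then the shorter length is a period of the longer
prefix. -/
theorem apply_add_eq_of_commute {w : ℕ → ℕ} (hw : ∀ i, 1 ≤ w i) {l n : ℕ}
    (h : Commute (wordMatrix (prefixWord w l)) (wordMatrix (prefixWord w n))) {i : ℕ}
    (hi : i + l < n) : w (i + l) = w i := by
  -- The two concatenations have the same length and the same matrix; comparing their letters at
  -- position i + l gives the period.
  have hcomm : prefixWord w l ++ prefixWord w n = prefixWord w n ++ prefixWord w l := by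
    refine eq_of_wordMatrix_eq ?_ ?_ (by simp [add_comm]) ?_
    · simp only [List.mem_append]
      rintro a (ha | ha) <;> exact one_le_of_mem_prefixWord hw _ a ha
    · simp only [List.mem_append]
      rintro a (ha | ha) <;> exact one_le_of_mem_prefixWord hw _ a ha
    · rw [wordMatrix_append, wordMatrix_append, h.eq]
  have h1 := congrArg (fun u : List ℕ => u[i + l]?) hcomm
  rw [List.getElem?_append_right (by simp [length_prefixWord]),
    List.getElem?_append_left (by simpa [length_prefixWord] using hi), length_prefixWord,
    List.getElem?_eq_getElem (by rw [length_prefixWord]; omega),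
    List.getElem?_eq_getElem (by rw [length_prefixWord]; omega),
    getElem_prefixWord, getElem_prefixWord] at h1
  simpa using h1.symm

/-- A recurrent word with a periodic tail is periodic. -/
theorem IsRecurrent.isPeriodic {w : ℕ → ℕ} (hw : IsRecurrent w) {n l : ℕ} (hl : 0 < l)
    (h : ∀ i, w (n + i + l) = w (n + i)) : IsPeriodic w := by
  refine ⟨l, hl, funext fun i => ?_⟩
  rw [shift_iterate_apply]
  -- The first i + l + 1 letters occur again beyond position n, inside the periodic tail.
  have hinf := hw (prefixWord w (i + l + 1)) ⟨0, by rw [length_prefixWord]; rfl⟩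
  obtain ⟨m, hm, hnm⟩ := hinf.exists_gt n
  rw [Set.mem_ofPred_eq, length_prefixWord] at hm
  have key : ∀ j < i + l + 1, w (j + m) = w j := by
    intro j hj
    have := congrArg (fun u : List ℕ => u[j]?) hm
    simpa [prefixWord, hj, shift_iterate_apply] using this
  have h1 := key (i + l) (by omega)
  have h2 := key i (by omega)
  have h3 := h (m - n + i)
  rw [show n + (m - n + i) + l = i + l + m by omega, show n + (m - n + i) = i + m by omega] at h3
  rw [← h1, ← h2, h3]

end Words

/-! ### Return times of the residue sets. -/

section Residues

variable {p : ℕ}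

/-- Prepending the prefix of length m to a prefix of the shifted word gives a prefix of w. Hence
U_k(w) is stable under left multiplication by A_{w_m}, and it contains the identity. -/
theorem reduction_pow_mem_prefixResidues {k m : ℕ} {w : ℕ → ℕ}
    (h : prefixResidues p k (shift^[m] w) = prefixResidues p k w) (j : ℕ) :
    reduction p k (wordMatrix (prefixWord w m) ^ j) ∈ prefixResidues p k w := by
  induction j with
  | zero => exact ⟨0, by simp [prefixWord, wordMatrix]⟩
  | succ j ih =>
    rw [← h] at ih
    obtain ⟨n, hn⟩ := ih
    refine ⟨m + n, ?_⟩
    simp only at hn ⊢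
    rw [prefixWord_add, wordMatrix_append, map_mul, hn, ← map_mul, pow_succ']

theorem reduction_eq_iff {k : ℕ} {g h : GL (Fin 2) ℤ} :
    reduction p k g = reduction p k h ↔ ∀ i j, (p ^ k : ℤ) ∣ g.val i j - h.val i j := by
  rw [← Units.val_inj, ← Matrix.ext_iff]
  refine forall_congr' fun i => forall_congr' fun j => ?_
  have h1 : ∀ g : GL (Fin 2) ℤ, (reduction p k g).val i j = ((g.val i j : ℤ) : ZMod (p ^ k)) :=
    fun g => rfl
  rw [h1, h1, eq_comm, ZMod.intCast_eq_intCast_iff_dvd_sub]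
  push_cast
  rfl

theorem reduction_eq_of_le {k l : ℕ} (hkl : k ≤ l) {g h : GL (Fin 2) ℤ}
    (hgh : reduction p l g = reduction p l h) : reduction p k g = reduction p k h := by
  rw [reduction_eq_iff] at hgh ⊢
  exact fun i j => (pow_dvd_pow _ hkl).trans (hgh i j)

theorem prefixResidues_eq_of_le {k l : ℕ} (hkl : k ≤ l) {w v : ℕ → ℕ}
    (h : prefixResidues p l w = prefixResidues p l v) :
    prefixResidues p k w = prefixResidues p k v := by
  have aux : ∀ {w v : ℕ → ℕ}, prefixResidues p l w = prefixResidues p l v →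
      prefixResidues p k w ⊆ prefixResidues p k v := by
    rintro w v h _ ⟨n, rfl⟩
    obtain ⟨m, hm⟩ : reduction p l (wordMatrix (prefixWord w n)) ∈ prefixResidues p l v :=
      h ▸ ⟨n, rfl⟩
    exact ⟨m, reduction_eq_of_le hkl hm⟩
  exact (aux h).antisymm (aux h.symm)

/-- If the number of residue sets is bounded uniformly in the exponent, then infinitely many
tails of the word have the same residue sets for all exponents at once. -/
theorem exists_infinite_prefixResidues_eq (w : ℕ → ℕ)
    (hbdd : ∃ C : ℕ, ∀ k : ℕ, 1 ≤ k → (residueCollection p k w).encard ≤ C) :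
    ∃ n : ℕ, {m | ∀ k, prefixResidues p k (shift^[m] w) =
      prefixResidues p k (shift^[n] w)}.Infinite := by
  obtain ⟨C, hC⟩ := hbdd
  let F : ℕ → (k : ℕ) → Set (GL (Fin 2) (ZMod (p ^ k))) :=
    fun n k => prefixResidues p k (shift^[n] w)
  -- C + 1 distinct sequences of residue sets would already be distinct at one common level L, since
  -- equality at a level implies equality at all lower ones.
  have hfin : (Set.range F).Finite := by
    by_contra hinf
    obtain ⟨T, hT, hTcard⟩ := Set.Infinite.exists_subset_card_eq hinf (C + 1)
    have hsep : ∀ x : (k : ℕ) → Set (GL (Fin 2) (ZMod (p ^ k))), ∀ y, ∃ k, x ≠ y → x k ≠ y k := by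
      intro x y
      by_cases hxy : x = y
      · exact ⟨0, fun h => absurd hxy h⟩
      · obtain ⟨k, hk⟩ := Function.ne_iff.mp hxy
        exact ⟨k, fun _ => hk⟩
    choose K hK using hsep
    -- The + 1 makes L positive, as the bound is only given for k ≥ 1.
    let L := (T ×ˢ T).sup (fun x => K x.1 x.2) + 1
    have hinj : Set.InjOn (fun x : (k : ℕ) → Set (GL (Fin 2) (ZMod (p ^ k))) => x L) T := by
      intro x hx y hy hxy
      by_contra hne
      have hle : K x y ≤ L :=
        (Finset.le_sup (f := fun x => K x.1 x.2) (Finset.mk_mem_product hx hy)).trans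
          (Nat.le_succ _)
      obtain ⟨m, rfl⟩ := hT hx
      obtain ⟨n, rfl⟩ := hT hy
      exact hK _ _ hne (prefixResidues_eq_of_le hle hxy)
    have hsub : (fun x : (k : ℕ) → Set (GL (Fin 2) (ZMod (p ^ k))) => x L) '' T ⊆
        residueCollection p L w := by
      rintro _ ⟨x, hx, rfl⟩
      obtain ⟨m, rfl⟩ := hT hx
      exact ⟨m, rfl⟩
    have h1 := (Set.encard_le_encard hsub).trans (hC L (Nat.le_add_left _ _))
    rw [hinj.encard_image, Set.encard_coe_eq_coe_finsetCard, hTcard] at h1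
    have : C + 1 ≤ C := by exact_mod_cast h1
    omega
  have : Finite (Set.range F) := hfin
  obtain ⟨⟨_, n, rfl⟩, hn⟩ := Finite.exists_infinite_fiber (Set.rangeFactorization F)
  refine ⟨n, ?_⟩
  rw [Set.infinite_coe_iff] at hn
  refine hn.mono fun m hm k => ?_
  exact congrFun (congrArg Subtype.val hm) k

end Residues

/-! ### Points of the projective line along the orbit. -/

section Points

variable {p : ℕ} [Fact p.Prime]

/-- The vector over the `n`-th iterate of the extended shift. -/
noncomputable def orbitVector (w : ℕ → ℕ) (V : Fin 2 → ℚ_[p]) : ℕ → Fin 2 → ℚ_[p]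
  | 0 => V
  | n + 1 => ![orbitVector w V n 1, orbitVector w V n 0 + w n * orbitVector w V n 1]

theorem map_letterMatrix_smul (a : ℕ) (V : Fin 2 → ℚ_[p]) :
    Matrix.GeneralLinearGroup.map (Int.castRingHom ℚ_[p]) (letterMatrix a) • V =
      ![V 1, V 0 + a * V 1] := by
  ext i
  fin_cases i <;> simp [letterMatrix]

theorem orbitVector_succ (w : ℕ → ℕ) (V : Fin 2 → ℚ_[p]) (n : ℕ) :
    orbitVector w V (n + 1) =
      Matrix.GeneralLinearGroup.map (Int.castRingHom ℚ_[p]) (letterMatrix (w n)) •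
        orbitVector w V n := by
  rw [map_letterMatrix_smul]; rfl

theorem orbitVector_ne_zero (w : ℕ → ℕ) {V : Fin 2 → ℚ_[p]} (hV : V ≠ 0) (n : ℕ) :
    orbitVector w V n ≠ 0 := by
  induction n with
  | zero => exact hV
  | succ n ih => rw [orbitVector_succ]; exact (smul_ne_zero_iff_ne _).mpr ih

theorem extShift_iterate_fst (x : (ℕ → ℕ) × ℙ ℚ_[p] (Fin 2 → ℚ_[p])) (n : ℕ) :
    ((extShift p)^[n] x).1 = shift^[n] x.1 := by
  induction n with
  | zero => rfl
  | succ n ih => rw [Function.iterate_succ_apply', Function.iterate_succ_apply', ← ih]; rfl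

theorem extShift_iterate_succ_snd (x : (ℕ → ℕ) × ℙ ℚ_[p] (Fin 2 → ℚ_[p])) (n : ℕ) :
    ((extShift p)^[n + 1] x).2 =
      Matrix.GeneralLinearGroup.map (Int.castRingHom ℚ_[p]) (letterMatrix (x.1 n)) •
        ((extShift p)^[n] x).2 := by
  rw [Function.iterate_succ_apply', extShift, extShift_iterate_fst, shift_iterate_apply, zero_add]

theorem extShift_iterate_mk (w : ℕ → ℕ) {V : Fin 2 → ℚ_[p]} (hV : V ≠ 0) (n : ℕ) :
    ((extShift p)^[n] (w, Projectivization.mk ℚ_[p] V hV)).2 =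
      Projectivization.mk ℚ_[p] (orbitVector w V n) (orbitVector_ne_zero w hV n) := by
  induction n with
  | zero => rfl
  | succ n ih =>
    rw [extShift_iterate_succ_snd, ih, Projectivization.smul_mk]
    congr 1
    exact (orbitVector_succ w V n).symm

theorem extShift_iterate_snd_injective (w : ℕ → ℕ) (n : ℕ) :
    Function.Injective fun q : ℙ ℚ_[p] (Fin 2 → ℚ_[p]) => ((extShift p)^[n] (w, q)).2 := by
  induction n with
  | zero => exact fun _ _ h => h
  | succ n ih =>
    intro q r h
    simp only [extShift_iterate_succ_snd] at h
    exact ih (smul_left_cancel _ h)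

theorem extShift_iterate_mem_lMad {x : (ℕ → ℕ) × ℙ ℚ_[p] (Fin 2 → ℚ_[p])} (hx : x ∈ lMad p)
    (n : ℕ) : (extShift p)^[n] x ∈ lMad p := by
  obtain ⟨ε, hε, h⟩ := hx
  refine ⟨ε, hε, fun m => ?_⟩
  rw [← Function.iterate_add_apply]
  exact h _

/-- Each letter matrix is symmetric, so its action on V can be moved to the linear form, which puts
the letters in the order of the word. -/
theorem pairing_orbitVector (w : ℕ → ℕ) (V : Fin 2 → ℚ_[p]) (n : ℕ) (v : Fin 2 → ℤ) :
    pairing (orbitVector w V n) v = pairing V ((wordMatrix (prefixWord w n)).val *ᵥ v) := by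
  induction n generalizing v with
  | zero => simp [prefixWord, wordMatrix, orbitVector]
  | succ n ih =>
    rw [prefixWord_succ, wordMatrix_append, wordMatrix_singleton, Units.val_mul,
      ← Matrix.mulVec_mulVec, ← ih, letterMatrix_mulVec]
    simp [pairing, orbitVector]
    ring

/-- Letter matrices have integral inverses, so they cannot shrink the maximum norm. This turns the
normalised bound of `pBad` into an absolute one. -/
theorem le_max_norm_orbitVector (w : ℕ → ℕ) (V : Fin 2 → ℚ_[p]) (n : ℕ) :
    max ‖V 0‖ ‖V 1‖ ≤ max ‖orbitVector w V n 0‖ ‖orbitVector w V n 1‖ := by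
  induction n with
  | zero => exact le_rfl
  | succ n ih =>
    refine ih.trans ?_
    generalize hU : orbitVector w V n = U
    have h0 : orbitVector w V (n + 1) 0 = U 1 := by simp [orbitVector, hU]
    have h1 : orbitVector w V (n + 1) 1 = U 0 + w n * U 1 := by simp [orbitVector, hU]
    rw [h0, h1]
    refine max_le ?_ (le_max_left _ _)
    have h2 : U 0 = (U 0 + w n * U 1) + -(w n * U 1) := by ring
    have h3 : ‖U 0‖ ≤ max ‖U 0 + w n * U 1‖ ‖-(w n * U 1)‖ := by
      conv_lhs => rw [h2]
      exact Padic.nonarchimedean _ _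
    refine h3.trans (max_le (le_max_right _ _) ((le_of_eq ?_).trans
      ((mul_le_of_le_one_left (norm_nonneg (U 1)) (Padic.norm_int_le_one (p := p) (w n))).trans
        (le_max_left _ _))))
    rw [norm_neg, norm_mul, Int.cast_natCast]

/-- Along a pair in `lMad`, the values of each nonzero linear form are bounded away from zero. -/
theorem exists_le_norm_pairing {w : ℕ → ℕ} {V : Fin 2 → ℚ_[p]} {hV : V ≠ 0}
    (h : (w, Projectivization.mk ℚ_[p] V hV) ∈ lMad p) {v : Fin 2 → ℤ} (hv : v ≠ 0) :
    ∃ η : ℝ, 0 < η ∧ ∀ n, η ≤ ‖pairing V ((wordMatrix (prefixWord w n)).val *ᵥ v)‖ := by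
  obtain ⟨ε, hε, h⟩ := h
  have hv' : (v 0, v 1) ≠ (0, 0) := by
    intro h0
    rw [Prod.mk.injEq] at h0
    exact hv (by ext i; fin_cases i; exacts [h0.1, h0.2])
  have hmax : 0 < max (|(v 0 : ℝ)| ^ 2) (|(v 1 : ℝ)| ^ 2) := by
    by_contra hle
    rw [not_lt, max_le_iff] at hle
    refine hv' ?_
    have : ∀ z : ℤ, |(z : ℝ)| ^ 2 ≤ 0 → z = 0 := fun z hz => by
      have := pow_eq_zero_iff (two_ne_zero) |>.mp (le_antisymm hz (by positivity))
      exact_mod_cast abs_eq_zero.mp this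
    rw [this _ hle.1, this _ hle.2]
  have hV' : 0 < max ‖V 0‖ ‖V 1‖ := by
    by_contra hle
    rw [not_lt, max_le_iff, norm_le_zero_iff, norm_le_zero_iff] at hle
    exact hV (by ext i; fin_cases i; exacts [hle.1, hle.2])
  refine ⟨(max (|(v 0 : ℝ)| ^ 2) (|(v 1 : ℝ)| ^ 2))⁻¹ * ε * max ‖V 0‖ ‖V 1‖, by positivity,
    fun n => ?_⟩
  have h2 := (h n).2
  rw [extShift_iterate_mk, mk_mem_pBad] at h2
  have h3 := h2 (v 0) (v 1) hv'
  have hle := le_max_norm_orbitVector w V n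
  rw [← div_eq_mul_inv, le_div_iff₀ (hV'.trans_le hle)] at h3
  rw [← pairing_orbitVector]
  exact (mul_le_mul_of_nonneg_left hle (by positivity)).trans h3

theorem norm_pairing_le_of_dvd (V : Fin 2 → ℚ_[p]) (k : ℕ) {v : Fin 2 → ℤ}
    (hv : ∀ i, (p ^ k : ℤ) ∣ v i) :
    ‖pairing V v‖ ≤ (p : ℝ) ^ (-k : ℤ) * max ‖V 0‖ ‖V 1‖ := by
  have h : ∀ i, ‖(v i : ℚ_[p])‖ ≤ (p : ℝ) ^ (-k : ℤ) := fun i =>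
    (Padic.norm_int_le_pow_iff_dvd (p := p) (v i) k).mpr (by exact_mod_cast hv i)
  refine (Padic.nonarchimedean _ _).trans (max_le ?_ ?_) <;> rw [norm_mul]
  · exact mul_le_mul (h 0) (le_max_left _ _) (norm_nonneg _) (by positivity)
  · exact mul_le_mul (h 1) (le_max_right _ _) (norm_nonneg _) (by positivity)

theorem pairing_sub (V : Fin 2 → ℚ_[p]) (u v : Fin 2 → ℤ) :
    pairing V (u - v) = pairing V u - pairing V v := by
  simp [pairing]; ring

/-- A return of the residue sets makes the point an eigenvector. -/
theorem eigenForm_eq_zero_of_mem_lMad {w : ℕ → ℕ} (hw : ∀ i, 1 ≤ w i) {V : Fin 2 → ℚ_[p]}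
    {hV : V ≠ 0} (h : (w, Projectivization.mk ℚ_[p] V hV) ∈ lMad p) {m : ℕ} (hm : 0 < m)
    (hres : ∀ k, prefixResidues p k (shift^[m] w) = prefixResidues p k w) :
    eigenForm (wordMatrix (prefixWord w m)).val V = 0 := by
  refine eigenForm_eq_zero _ ?_ ?_ V fun v hv => ?_
  · exact (Matrix.isUnit_iff_isUnit_det _).mp (wordMatrix (prefixWord w m)).isUnit
  · exact fun n hn => ((wordMatrix_prefixWord_secondColumnPos hw hm).pow hn).2.2.1.ne'
  · obtain ⟨η, hη, hle⟩ := exists_le_norm_pairing h hv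
    refine ⟨η, hη, fun j => ?_⟩
    have hp1 : (p : ℝ)⁻¹ < 1 :=
      inv_lt_one_of_one_lt₀ (by exact_mod_cast (Fact.out : p.Prime).one_lt)
    obtain ⟨k, hk⟩ : ∃ k : ℕ, (p : ℝ) ^ (-k : ℤ) * max ‖V 0‖ ‖V 1‖ < η := by
      obtain ⟨k, hk⟩ := exists_pow_lt_of_lt_one
        (div_pos hη (show 0 < max ‖V 0‖ ‖V 1‖ + 1 by positivity)) hp1
      refine ⟨k, ?_⟩
      rw [zpow_neg, zpow_natCast, ← inv_pow]
      rw [lt_div_iff₀ (by positivity)] at hk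
      refine lt_of_le_of_lt (mul_le_mul_of_nonneg_left ?_ (by positivity)) hk
      linarith
    -- A^j agrees modulo p^k with some prefix matrix, and k was chosen so that the two values at v
    -- differ by less than η; by the ultrametric inequality a value of A^j below η would force one
    -- of the prefix matrix below η.
    obtain ⟨n, hn⟩ := reduction_pow_mem_prefixResidues (hres k) j
    rw [reduction_eq_iff, Units.val_pow_eq_pow_val] at hn
    specialize hle n
    by_contra hlt
    rw [not_le] at hlt
    set A := (wordMatrix (prefixWord w n)).val
    set B := (wordMatrix (prefixWord w m)).val ^ j
    have hdiff := norm_pairing_le_of_dvd V k (v := A *ᵥ v - B *ᵥ v) (fun i => by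
      rw [← Matrix.sub_mulVec, Matrix.mulVec, dotProduct]
      exact Finset.dvd_sum (f := fun l => (A - B) i l * v l) fun l _ => (hn i l).mul_right _)
    have heq : pairing V (A *ᵥ v) = pairing V (A *ᵥ v - B *ᵥ v) + pairing V (B *ᵥ v) := by
      rw [pairing_sub]; ring
    rw [heq] at hle
    exact absurd (hle.trans (Padic.nonarchimedean _ _))
      (not_le.mpr (max_lt (hdiff.trans_lt hk) hlt))

theorem pairing_ne_zero_of_mem_lMad {w : ℕ → ℕ} {V : Fin 2 → ℚ_[p]} {hV : V ≠ 0}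
    (h : (w, Projectivization.mk ℚ_[p] V hV) ∈ lMad p) {v : Fin 2 → ℤ} (hv : v ≠ 0) :
    pairing V v ≠ 0 := by
  obtain ⟨η, hη, hle⟩ := exists_le_norm_pairing h hv
  intro h0
  have := hle 0
  simp [prefixWord, wordMatrix, h0] at this
  linarith

/-- The eigenvalue equation for V, with eigenvalue (A₀₀V₀ + A₁₀V₁)/V₀ and its denominator cleared.
-/
theorem pairing_mulVec_mul_of_eigenForm_eq_zero {V : Fin 2 → ℚ_[p]}
    {A : Matrix (Fin 2) (Fin 2) ℤ} (hA : eigenForm A V = 0) (v : Fin 2 → ℤ) :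
    pairing V (A *ᵥ v) * V 0 = (A 0 0 * V 0 + A 1 0 * V 1) * pairing V v := by
  rw [eigenForm] at hA
  rw [pairing_mulVec, pairing]
  linear_combination (v 1 : ℚ_[p]) * hA

/-- Integral matrices with a common irrational left eigenvector commute. -/
theorem commute_of_eigenForm_eq_zero {V : Fin 2 → ℚ_[p]}
    (hirr : ∀ v : Fin 2 → ℤ, v ≠ 0 → pairing V v ≠ 0) {A B : Matrix (Fin 2) (Fin 2) ℤ}
    (hA : eigenForm A V = 0) (hB : eigenForm B V = 0) : Commute A B := by
  have hV0 : V 0 ≠ 0 := by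
    simpa [pairing] using hirr ![1, 0] (by simp)
  -- On V both products act by the product of the two eigenvalues. So V annihilates the integral
  -- columns of the commutator, which vanish by irrationality.
  have key : ∀ v : Fin 2 → ℤ, pairing V ((A * B - B * A) *ᵥ v) = 0 := by
    intro v
    rw [Matrix.sub_mulVec, pairing_sub, ← Matrix.mulVec_mulVec, ← Matrix.mulVec_mulVec]
    refine (mul_eq_zero_iff_left (pow_ne_zero 2 hV0)).mp ?_
    linear_combination V 0 * pairing_mulVec_mul_of_eigenForm_eq_zero hA (B *ᵥ v) -
      V 0 * pairing_mulVec_mul_of_eigenForm_eq_zero hB (A *ᵥ v) +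
      (A 0 0 * V 0 + A 1 0 * V 1) * pairing_mulVec_mul_of_eigenForm_eq_zero hB v -
      (B 0 0 * V 0 + B 1 0 * V 1) * pairing_mulVec_mul_of_eigenForm_eq_zero hA v
  rw [Commute, SemiconjBy, ← sub_eq_zero]
  ext i j
  have hcol : (A * B - B * A) *ᵥ Pi.single j 1 = 0 := by
    by_contra hne
    exact hirr _ hne (key _)
  simpa using congrFun hcol i

/-- As A₀₁ ≠ 0, no zero has V₁ = 0, and V₀/V₁ is a root of a genuine quadratic. -/
theorem encard_eigenForm_le_two {A : Matrix (Fin 2) (Fin 2) ℤ} (hA : A 0 1 ≠ 0) :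
    {q : ℙ ℚ_[p] (Fin 2 → ℚ_[p]) | eigenForm A q.rep = 0}.encard ≤ 2 := by
  have hA' : (A 0 1 : ℚ_[p]) ≠ 0 := by exact_mod_cast hA
  classical
  let P : Polynomial ℚ_[p] := Polynomial.C (A 0 1 : ℚ_[p]) * Polynomial.X ^ 2 +
    Polynomial.C (A 1 1 - A 0 0 : ℚ_[p]) * Polynomial.X + Polynomial.C (-A 1 0 : ℚ_[p])
  have hdeg : P.natDegree = 2 := Polynomial.natDegree_quadratic hA'
  have hP : P ≠ 0 := by
    intro h0
    rw [h0] at hdeg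
    simp at hdeg
  have hne : ∀ q : ℙ ℚ_[p] (Fin 2 → ℚ_[p]), eigenForm A q.rep = 0 → q.rep 1 ≠ 0 := by
    intro q hq h1
    refine q.rep_nonzero ?_
    have h0 : q.rep 0 = 0 := by
      rw [eigenForm, h1] at hq
      simpa [hA'] using hq
    ext i
    fin_cases i
    exacts [h0, h1]
  have hmaps : Set.MapsTo (fun q : ℙ ℚ_[p] (Fin 2 → ℚ_[p]) => q.rep 0 / q.rep 1)
      {q | eigenForm A q.rep = 0} (P.roots.toFinset : Set ℚ_[p]) := by
    intro q hq
    have h1 := hne q hq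
    rw [Finset.mem_coe, Multiset.mem_toFinset, Polynomial.mem_roots hP]
    have h2 : eigenForm A q.rep = 0 := hq
    rw [eigenForm] at h2
    simp only [P, Polynomial.IsRoot, Polynomial.eval_add, Polynomial.eval_mul, Polynomial.eval_C,
      Polynomial.eval_pow, Polynomial.eval_X]
    field_simp
    linear_combination h2
  have hinj : Set.InjOn (fun q : ℙ ℚ_[p] (Fin 2 → ℚ_[p]) => q.rep 0 / q.rep 1)
      {q | eigenForm A q.rep = 0} := by
    intro q hq r hr hqr
    have h1 := hne q hq
    have h2 := hne r hr
    simp only at hqr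
    rw [← q.mk_rep, ← r.mk_rep, Projectivization.mk_eq_mk_iff']
    refine ⟨q.rep 1 / r.rep 1, ?_⟩
    ext i
    fin_cases i
    · simp only [Pi.smul_apply, smul_eq_mul, Fin.zero_eta]
      field_simp at hqr ⊢
      linear_combination -hqr
    · simp [h2]
  refine (Set.encard_le_encard_of_injOn hmaps hinj).trans ?_
  rw [Set.encard_coe_eq_coe_finsetCard]
  have := (Multiset.toFinset_card_le P.roots).trans (P.card_roots'.trans hdeg.le)
  exact_mod_cast this

end Points

end LimitMad

/-! ### Proof of the proposition. -/

theorem proposition8p2 (p : ℕ) [Fact p.Prime] (N : ℕ) (w : ℕ → ℕ)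
    (hw : ∀ i, w i ∈ LimitMad.alphabet N)
    (hrec : LimitMad.IsRecurrent w)
    (hbdd : ∃ C : ℕ, ∀ k : ℕ, 1 ≤ k → (LimitMad.residueCollection p k w).encard ≤ C) :
    {q : ℙ ℚ_[p] (Fin 2 → ℚ_[p]) | (w, q) ∈ LimitMad.lMad p}.encard ≤ 2 ∧
      (¬ LimitMad.IsPeriodic w →
        ∀ q : ℙ ℚ_[p] (Fin 2 → ℚ_[p]), (w, q) ∉ LimitMad.lMad p) := by
  obtain ⟨n, hn⟩ := LimitMad.exists_infinite_prefixResidues_eq w hbdd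
  set y := LimitMad.shift^[n] w with hy
  have hy1 : ∀ i, 1 ≤ y i := fun i => by
    rw [hy, LimitMad.shift_iterate_apply]
    exact (hw _).1
  have hfreq : ∀ L, ∃ m, L < m ∧ ∀ k, LimitMad.prefixResidues p k (LimitMad.shift^[m] y) =
      LimitMad.prefixResidues p k y := by
    intro L
    obtain ⟨m, hm, hlt⟩ := hn.exists_gt (L + n)
    refine ⟨m - n, by omega, fun k => ?_⟩
    rw [hy, ← Function.iterate_add_apply, Nat.sub_add_cancel (by omega)]
    exact hm k
  have hmem : ∀ q, (w, q) ∈ LimitMad.lMad p →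
      (y, Projectivization.mk ℚ_[p] (((LimitMad.extShift p)^[n] (w, q)).2.rep)
        (Projectivization.rep_nonzero _)) ∈ LimitMad.lMad p := by
    intro q hq
    have h := LimitMad.extShift_iterate_mem_lMad hq n
    rw [Projectivization.mk_rep]
    convert h using 1
    exact Prod.ext (LimitMad.extShift_iterate_fst (w, q) n).symm rfl
  obtain ⟨l, hl, hlres⟩ := hfreq 0
  refine ⟨?_, fun hper q hq => hper ?_⟩
  -- The shift acts on points by invertible matrices, so counting may be done for the tail y.
  · refine le_trans (Set.encard_le_encard_of_injOn
      (f := fun q => ((LimitMad.extShift p)^[n] (w, q)).2) (fun q hq => ?_)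
      (LimitMad.extShift_iterate_snd_injective w n).injOn) (LimitMad.encard_eigenForm_le_two
        (LimitMad.wordMatrix_prefixWord_secondColumnPos hy1 hl).2.2.1.ne')
    exact LimitMad.eigenForm_eq_zero_of_mem_lMad hy1 (hmem q hq) hl hlres
  · refine hrec.isPeriodic (n := n) hl fun i => ?_
    -- The period l stays fixed; a second return time m beyond i + l shows that it holds at position
    -- i.
    obtain ⟨m, hm, hmres⟩ := hfreq (i + l)
    have hq' := hmem q hq
    have hcomm := LimitMad.commute_of_eigenForm_eq_zero
      (fun v hv => LimitMad.pairing_ne_zero_of_mem_lMad hq' hv)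
      (LimitMad.eigenForm_eq_zero_of_mem_lMad hy1 hq' hl hlres)
      (LimitMad.eigenForm_eq_zero_of_mem_lMad hy1 hq' (by omega) hmres)
    have h := LimitMad.apply_add_eq_of_commute hy1 (Units.ext hcomm.eq) hm
    rw [hy, LimitMad.shift_iterate_apply, LimitMad.shift_iterate_apply] at h
    rw [show n + i + l = i + l + n by ring, add_comm n i]
    exact h
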